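/- A $\mathcal D_1$-chart on a set $X$ is a pair $(U,k)$ with $U\subset\mathbb R$ open and $k:U\to X$ an arbitrary map; a morphism $(U_1,k_1)\to(U_2,k_2)$ is an étale map $\varphi:U_1\to U_2$ (smooth, with nowhere vanishing derivative) such that $k_2\circ\varphi=k_1$. A $\mathcal D_1$-space is a set $X$ with a set $\Phi$ of charts such that $X$ is the colimit, in the category of sets, of the domains of the charts of $\Phi$ over all morphisms of charts, and which is maximal in the following sense: $(V,k\circ m)\in\Phi$ whenever $(U,k)\in\Phi$ and $m:V\to U$ is étale, and $(U,k)\in\Phi$ whenever $U$ has an open cover $\{U_i\}$ with $(U_i,k|_{U_i})\in\Phi$ for all $i$. For $U\subset\mathbb R$ open, let $S(U)$ be the space of jets $j_0^\infty f$ of maps $f$ from $\mathbb R$ to $U$ regular at $0$, with the coordinates $z_p=f^{(p)}(0)$, $p\ge 0$; thus $S(U)=\{z\in\mathbb R^\infty: z_0\in U,\ z_1\neq 0\}$. Put $y_0=z_0$, $y_1=z_1$ and $y_p=z_p/z_1^p$ for $p\ge2$. A differential form on $S(U)$ is a form that is locally the pull-back of a smooth form on an open subset of some $\mathbb R^N$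 under the projection $\mathbb R^\infty\to\mathbb R^N$. An étale map $\varphi:U\to V$ induces $S(\varphi):S(U)\to S(V)$, $j_0^\infty f\mapsto j^\infty_0(\varphi\circ f)$. For a $\mathcal D_1$-space $X$, an element of $\Omega^k(S(X))$ is a family of $k$-forms on the spaces $S(U)$, one for each chart $(U,k)\in\Phi$, that is compatible with the pull-backs under $S(\varphi)$ for all morphisms $\varphi$ of charts. The canonical forms $\theta_r\in\Omega^1(S(X))$, $r\geq 0$, are defined by the Gelfand–Kazhdan form $\theta=\sum_{r\ge0}\frac1{r!}\theta_rt^r\frac{d}{dt}$, $\theta\big(\tfrac{d}{du}\big|_{u=0}j_0^\infty k_u\big)=-j_0^\infty\tfrac{d}{du}\big|_{u=0}(k_0^{-1}\circ k_u)$; in coordinates $$\theta_0=-\frac{dy_0}{y_1},\qquad \theta_1=-\frac{dy_1}{y_1}+y_2\,dy_0,\qquad \theta_3=-y_1^2dy_3+3y_2y_1^2dy_2+y_1^2(y_4+6y_2^3-6y_2y_3)dy_0 .$$ Let $H^*_{\theta_1\wedge\theta_0}(S(X))$ be the cohomology of the complex $\Omega^{*-2}(S(X))\wedge\theta_1\wedge\theta_0$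 with the exterior derivative. Let $\mathrm S(\varphi)=\frac{\varphi'''}{\varphi'}-\frac32\left(\frac{\varphi''}{\varphi'}\right)^2$ be the Schwarzian derivative. **Proposition.** Let $X$ be a $\mathcal D_1$-space. Then $\theta_3\wedge\theta_1\wedge\theta_0$ is a cocycle of degree $3$ of this complex, and its class $$[\theta_3\wedge\theta_1\wedge\theta_0]\in H^3_{\theta_1\wedge\theta_0}(S(X))$$ is trivial if and only if one can assign to every chart $(U,k)\in\Phi$, with coordinate denoted $y_0$, a smooth function $q_{y_0}(y_0,y_1)$ on the space $S_1(U)=\{(y_0,y_1):y_0\in U,\ y_1\ne0\}$ of first-order frames such that for every morphism of charts $t_0=\varphi(y_0)$ $$q_{t_0}\big(\varphi(y_0),\varphi'(y_0)y_1\big)\,(\varphi'(y_0))^2=q_{y_0}(y_0,y_1)-\mathrm S(\varphi)(y_0).$$ Consequently, if $X$ admits a projective connection, that is, if one can assign to every chart in $\Phi$, with coordinate denoted $w$, a smooth function $q_w(w)$ on its domain such that $q_t(\varphi(w))(\varphi'(w))^2=q_w(w)-\mathrm S(\varphi)(w)$ for every morphism of charts $t=\varphi(w)$, then the class $[\theta_3\wedge\theta_1\wedge\theta_0]$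 is trivial. -/

import Mathlib

open scoped ContDiff
open TopologicalSpace (Opens)

/-! ### One-dimensional generalized smooth spaces -/

/-- `m` is an étale map `U → V` between open subsets of `ℝ` (smooth with nowhere vanishing
derivative); the values of `m` outside `U` play no role. -/
structure IsEtale (U V : Opens ℝ) (m : ℝ → ℝ) : Prop where
  mapsTo : ∀ u ∈ U, m u ∈ V
  smooth : ContDiffOn ℝ ∞ m U
  regular : ∀ u ∈ U, deriv m u ≠ 0

/-- A one-dimensional chart on a set `X`: an open `U ⊆ ℝ` and an arbitrary map `U → X`. -/
structure LineChart (X : Type*) where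
  dom : Opens ℝ
  map : dom → X

namespace LineChart

variable {X : Type*}

/-- The chart `(V, k ∘ m)` obtained from the chart `(U, k)` and an étale map `m : V → U`. -/
def precomp (c : LineChart X) (V : Opens ℝ) (m : ℝ → ℝ) (hm : IsEtale V c.dom m) :
    LineChart X where
  dom := V
  map v := c.map ⟨m v, hm.mapsTo v v.2⟩

/-- The chart `(V, k|_V)`. -/
def restrict (c : LineChart X) (V : Opens ℝ) (h : V ≤ c.dom) : LineChart X where
  dom := V
  map v := c.map ⟨v, h v.2⟩

/-- A morphism of charts: an étale map `m : U₁ → U₂` with `k₂ ∘ m = k₁`. -/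
structure IsMorphism (c₁ c₂ : LineChart X) (m : ℝ → ℝ) : Prop where
  etale : IsEtale c₁.dom c₂.dom m
  comm : ∀ u : c₁.dom, c₂.map ⟨m u, etale.mapsTo u u.2⟩ = c₁.map u

end LineChart

/-- A `𝒟₁`-space structure on a set `X`: a maximal `𝒟₁`-atlas. The fields `surj` and `inj` say
that `X` is the colimit, in sets, of the domains of the charts over all morphisms of charts;
the fields `precomp_mem` and `local_mem` express the maximality of the atlas. -/
structure D1Space (X : Type*) where
  charts : Set (LineChart X)
  surj : ∀ x : X, ∃ c ∈ charts, ∃ u : c.dom, c.map u = x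
  inj : ∀ p q : (Σ c : charts, c.1.dom), p.1.1.map p.2 = q.1.1.map q.2 →
    Relation.EqvGen (fun a b : (Σ c : charts, c.1.dom) =>
      ∃ m : ℝ → ℝ, LineChart.IsMorphism a.1.1 b.1.1 m ∧ m a.2 = b.2) p q
  precomp_mem : ∀ c ∈ charts, ∀ (V : Opens ℝ) (m : ℝ → ℝ) (hm : IsEtale V c.dom m),
    c.precomp V m hm ∈ charts
  local_mem : ∀ c : LineChart X,
    (∀ u ∈ c.dom, ∃ (V : Opens ℝ) (h : V ≤ c.dom), u ∈ V ∧ c.restrict V h ∈ charts) →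
      c ∈ charts

/-! ### Frames of infinite order and forms on them -/

/-- `S(U)`: the jets `j₀^∞ f` of regular maps `f` from `ℝ` to `U`, through the coordinates
`z p = f⁽ᵖ⁾(0)`. (Every sequence with `z 0 ∈ U` and `z 1 ≠ 0` is the jet of such a map.) -/
def Frames (U : Opens ℝ) : Set (ℕ → ℝ) := {z | z 0 ∈ U ∧ z 1 ≠ 0}

/-- The coordinates of `j₀^∞ (h ∘ f)` in terms of the coordinates `z` of `j₀^∞ f`: the `n`-th
derivative at `0` of `h ∘ f` depends only on the `n`-jet of `f`, hence `f` may be replaced by its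
Taylor polynomial of degree `n`. -/
noncomputable def prolong (h : ℝ → ℝ) (z : ℕ → ℝ) (n : ℕ) : ℝ :=
  iteratedDeriv n (fun t : ℝ => h (∑ p ∈ Finset.range (n + 1), z p / p.factorial * t ^ p)) 0

theorem prolong_zero (h : ℝ → ℝ) (z : ℕ → ℝ) : prolong h z 0 = h (z 0) := by
  simp [prolong]

theorem prolong_one (h : ℝ → ℝ) (z : ℕ → ℝ) (hd : DifferentiableAt ℝ h (z 0)) :
    prolong h z 1 = deriv h (z 0) * z 1 := by
  have e : (fun t : ℝ => h (∑ p ∈ Finset.range (1 + 1), z p / p.factorial * t ^ p)) =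
      fun t => h (z 0 + z 1 * t) := by
    funext t
    simp [Finset.sum_range_succ]
  rw [prolong, iteratedDeriv_one, e]
  have h1 : HasDerivAt (fun t : ℝ => z 0 + z 1 * t) (z 1) 0 := by
    simpa using ((hasDerivAt_id (0 : ℝ)).const_mul (z 1)).const_add (z 0)
  have h2 : HasDerivAt h (deriv h (z 0)) (z 0 + z 1 * 0) := by simpa using hd.hasDerivAt
  exact (h2.comp 0 h1).deriv

theorem prolong_mem {U V : Opens ℝ} {m : ℝ → ℝ} (hm : IsEtale U V m) (z : Frames U) :
    prolong m z ∈ Frames V := by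
  have hz := z.2.1
  refine ⟨by rw [prolong_zero]; exact hm.mapsTo _ hz, ?_⟩
  have hd : DifferentiableAt ℝ m ((z : ℕ → ℝ) 0) :=
    ((hm.smooth.differentiableOn (by simp)).differentiableAt (U.isOpen.mem_nhds hz))
  rw [prolong_one m z hd]
  exact mul_ne_zero (hm.regular _ hz) z.2.2

/-- The map `S(m) : S(U) → S(V)` induced by an étale map `m : U → V`. -/
noncomputable def framesMap {U V : Opens ℝ} {m : ℝ → ℝ} (hm : IsEtale U V m) (z : Frames U) :
    Frames V :=
  ⟨prolong m z, prolong_mem hm z⟩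

/-- The differential of `S(m)` at `z`, applied to the tangent vector `v`. -/
noncomputable def framesTangent (m : ℝ → ℝ) (z v : ℕ → ℝ) : ℕ → ℝ :=
  fun n => lineDeriv ℝ (fun w : ℕ → ℝ => prolong m w n) z v

/-- Functions of a point of `S(U)` and `k` tangent vectors there; the `k`-forms are those
satisfying `IsForm`. -/
abbrev PreForm (U : Opens ℝ) (k : ℕ) : Type := Frames U → (Fin k → ℕ → ℝ) → ℝ

/-- The projection `ℝ^∞ → ℝ^N`. -/
def trunc (N : ℕ) (w : ℕ → ℝ) : Fin N → ℝ := fun j => w j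

/-- `α` is a smooth differential `k`-form on `S(U) ⊆ ℝ^∞`: locally it is the pull-back of a smooth
`k`-form on an open subset of some `ℝ^N`. -/
def IsForm {U : Opens ℝ} {k : ℕ} (α : PreForm U k) : Prop :=
  ∀ z : Frames U, ∃ (N : ℕ) (O : Set (Fin N → ℝ)), IsOpen O ∧ trunc N z ∈ O ∧
    ∃ η : (Fin N → ℝ) → (Fin N → ℝ) [⋀^Fin k]→L[ℝ] ℝ, ContDiffOn ℝ ∞ η O ∧
      ∀ w : Frames U, trunc N w ∈ O →
        ∀ v : Fin k → ℕ → ℝ, α w v = η (trunc N w) (fun i => trunc N (v i))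

open Classical in
/-- Extension by zero of `z ↦ α z v` from the open set `S(U)` to `ℝ^∞` (used only to take
directional derivatives at points of `S(U)`). -/
noncomputable def PreForm.extend {U : Opens ℝ} {k : ℕ} (α : PreForm U k) (v : Fin k → ℕ → ℝ)
    (w : ℕ → ℝ) : ℝ :=
  if h : w ∈ Frames U then α ⟨w, h⟩ v else 0

/-- The exterior derivative
`dα (v₀, …, v_k) = ∑ i, (-1)^i D_{v_i} (α (v₀, …, v̂_i, …, v_k))`. -/
noncomputable def PreForm.d {U : Opens ℝ} {k : ℕ} (α : PreForm U k) : PreForm U (k + 1) :=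
  fun z v => ∑ i : Fin (k + 1),
    (-1 : ℝ) ^ (i : ℕ) * lineDeriv ℝ (α.extend (i.removeNth v)) z (v i)

/-- The exterior product `β ∧ θ` of a `k`-form with a `1`-form,
`(β ∧ θ) (v₀, …, v_k) = ∑ i, (-1)^(k-i) β (v₀, …, v̂_i, …, v_k) θ (v_i)`. -/
def PreForm.wedge {U : Opens ℝ} {k : ℕ} (β : PreForm U k) (θ : PreForm U 1) :
    PreForm U (k + 1) :=
  fun z v => ∑ i : Fin (k + 1),
    (-1 : ℝ) ^ (k + (i : ℕ)) * (β z (i.removeNth v) * θ z (fun _ => v i))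

/-- The Gelfand-Kazhdan form with values in formal vector fields on the line: if `z` and `v` are
the coordinates of `j₀^∞ k₀` and of the velocity `k̇` of a curve `j₀^∞ k_u`, then
`d/du (k₀⁻¹ ∘ k_u) = k̇ / k₀'` at `u = 0`, and the value of the form is minus the Taylor series
of this function of `t`. -/
noncomputable def gelfandKazhdan (z v : ℕ → ℝ) : PowerSeries ℝ :=
  -(PowerSeries.mk (fun p => v p / p.factorial) * (PowerSeries.mk (fun p => z (p + 1) / p.factorial))⁻¹)

/-- The canonical `1`-forms `θ_r` on `S(U)`, the Gelfand-Kazhdan form being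
`∑ r, (1 / r!) θ_r t^r d/dt`. -/
noncomputable def canonicalForm (U : Opens ℝ) (r : ℕ) : PreForm U 1 :=
  fun z v => r.factorial * PowerSeries.coeff r (gelfandKazhdan z (v 0))

theorem canonicalForm_zero (U : Opens ℝ) (z : Frames U) (v : Fin 1 → ℕ → ℝ) :
    canonicalForm U 0 z v = -v 0 0 / z.1 1 := by
  simp [canonicalForm, gelfandKazhdan, div_eq_mul_inv]

theorem canonicalForm_one (U : Opens ℝ) (z : Frames U) (v : Fin 1 → ℕ → ℝ) :
    canonicalForm U 1 z v = -v 0 1 / z.1 1 + z.1 2 / z.1 1 ^ 2 * v 0 0 := by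
  have h1 : z.1 1 ≠ 0 := z.2.2
  set B : PowerSeries ℝ := PowerSeries.mk fun p => z.1 (p + 1) / p.factorial with hB
  have hm : B * B⁻¹ = 1 := PowerSeries.mul_inv_cancel _ (by simpa [hB] using h1)
  have e0 : PowerSeries.coeff 0 B⁻¹ = (z.1 1)⁻¹ := by simp [hB]
  have e1 := congrArg (PowerSeries.coeff 1) hm
  have hanti : Finset.HasAntidiagonal.antidiagonal (1 : ℕ) = {((0 : ℕ), (1 : ℕ)), (1, 0)} := rfl
  rw [PowerSeries.coeff_mul, hanti, Finset.sum_pair (by simp), e0] at e1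
  simp only [hB, PowerSeries.coeff_mk, PowerSeries.coeff_one] at e1
  rw [← hB] at e1
  simp only [canonicalForm, gelfandKazhdan, map_neg, PowerSeries.coeff_mul, hanti]
  rw [← hB, Finset.sum_pair (by simp), e0]
  simp only [PowerSeries.coeff_mk]
  have e2 : PowerSeries.coeff 1 B⁻¹ = -z.1 2 / z.1 1 ^ 2 := by
    field_simp
    norm_num at e1
    field_simp at e1
    linarith
  rw [e2]
  norm_num
  field_simp

/-- The form `θ₃` in the coordinates `y₀ = z₀`, `y₁ = z₁`, `y_p = z_p / z₁^p` for `p ≥ 2`, with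
`dy_p = dz_p / z₁^p - p z_p dz₁ / z₁^(p+1)`. -/
theorem canonicalForm_three (U : Opens ℝ) (z : Frames U) (v : Fin 1 → ℕ → ℝ)
    (y dy : ℕ → ℝ) (hy : ∀ p, y p = if p ≤ 1 then z.1 p else z.1 p / z.1 1 ^ p)
    (hdy : ∀ p, dy p = if p ≤ 1 then v 0 p else
      v 0 p / z.1 1 ^ p - p * z.1 p * v 0 1 / z.1 1 ^ (p + 1)) :
    canonicalForm U 3 z v = -y 1 ^ 2 * dy 3 + 3 * y 2 * y 1 ^ 2 * dy 2 +
      y 1 ^ 2 * (y 4 + 6 * y 2 ^ 3 - 6 * y 2 * y 3) * dy 0 := by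
  have h1 : z.1 1 ≠ 0 := z.2.2
  set B : PowerSeries ℝ := PowerSeries.mk fun p => z.1 (p + 1) / p.factorial with hB
  have hm : B * B⁻¹ = 1 := PowerSeries.mul_inv_cancel _ (by simpa [hB] using h1)
  have a0 : PowerSeries.coeff 0 B⁻¹ = (z.1 1)⁻¹ := by simp [hB]
  have e1 := congrArg (PowerSeries.coeff 1) hm
  have e2 := congrArg (PowerSeries.coeff 2) hm
  have e3 := congrArg (PowerSeries.coeff 3) hm
  simp only [PowerSeries.coeff_mul, Finset.Nat.sum_antidiagonal_eq_sum_range_succ_mk,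
    Finset.sum_range_succ, Finset.sum_range_zero, a0] at e1 e2 e3
  simp only [hB, PowerSeries.coeff_mk, PowerSeries.coeff_one] at e1 e2 e3
  rw [← hB] at e1 e2 e3
  norm_num [Nat.factorial, a0] at e1 e2 e3
  have a1 : PowerSeries.coeff 1 B⁻¹ = -z.1 2 / z.1 1 ^ 2 := by
    field_simp at e1 ⊢
    linarith
  rw [a1] at e2 e3
  have a2 : PowerSeries.coeff 2 B⁻¹ = z.1 2 ^ 2 / z.1 1 ^ 3 - z.1 3 / (2 * z.1 1 ^ 2) := by
    field_simp at e2 ⊢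
    linear_combination e2
  rw [a2] at e3
  have a3 : PowerSeries.coeff 3 B⁻¹ = -z.1 4 / (6 * z.1 1 ^ 2) + z.1 2 * z.1 3 / z.1 1 ^ 3
      - z.1 2 ^ 3 / z.1 1 ^ 4 := by
    field_simp at e3 ⊢
    linear_combination e3 / 2
  simp only [canonicalForm, gelfandKazhdan, map_neg, PowerSeries.coeff_mul,
    Finset.Nat.sum_antidiagonal_eq_sum_range_succ_mk]
  rw [← hB]
  simp only [Finset.sum_range_succ, Finset.sum_range_zero, PowerSeries.coeff_mk]
  norm_num [a0, a1, a2, a3, hy, hdy, Nat.factorial]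
  field_simp
  ring

/-! Linearity of the operations on forms. -/

namespace PreForm

variable {U : Opens ℝ} {k : ℕ}

theorem isForm_zero : IsForm (0 : PreForm U k) := fun _ =>
  ⟨0, Set.univ, isOpen_univ, trivial, 0, contDiffOn_const, fun _ _ _ => rfl⟩

theorem isForm_smul (c : ℝ) {α : PreForm U k} (h : IsForm α) : IsForm (c • α) := fun z => by
  obtain ⟨N, O, hO, hz, η, hη, e⟩ := h z
  refine ⟨N, O, hO, hz, c • η, hη.const_smul c, fun w hw v => ?_⟩
  simp [e w hw v]

/-- The projection `ℝ^M → ℝ^N` for `N ≤ M`. -/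
noncomputable def truncLE {N M : ℕ} (h : N ≤ M) : (Fin M → ℝ) →L[ℝ] (Fin N → ℝ) :=
  ContinuousLinearMap.pi fun j => ContinuousLinearMap.proj (Fin.castLE h j)

theorem truncLE_trunc {N M : ℕ} (h : N ≤ M) (w : ℕ → ℝ) :
    truncLE h (trunc M w) = trunc N w := rfl

theorem isForm_raise {α : PreForm U k} (z : Frames U) {N M : ℕ} (hNM : N ≤ M)
    (h : ∃ O : Set (Fin N → ℝ), IsOpen O ∧ trunc N z ∈ O ∧
      ∃ η : (Fin N → ℝ) → (Fin N → ℝ) [⋀^Fin k]→L[ℝ] ℝ, ContDiffOn ℝ ∞ η O ∧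
        ∀ w : Frames U, trunc N w ∈ O →
          ∀ v : Fin k → ℕ → ℝ, α w v = η (trunc N w) (fun i => trunc N (v i))) :
    ∃ O : Set (Fin M → ℝ), IsOpen O ∧ trunc M z ∈ O ∧
      ∃ η : (Fin M → ℝ) → (Fin M → ℝ) [⋀^Fin k]→L[ℝ] ℝ, ContDiffOn ℝ ∞ η O ∧
        ∀ w : Frames U, trunc M w ∈ O →
          ∀ v : Fin k → ℕ → ℝ, α w v = η (trunc M w) (fun i => trunc M (v i)) := by
  obtain ⟨O, hO, hz, η, hη, e⟩ := h
  refine ⟨truncLE hNM ⁻¹' O, hO.preimage (truncLE hNM).continuous, hz,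
    fun x => (η (truncLE hNM x)).compContinuousLinearMap (truncLE hNM), ?_, ?_⟩
  · have h1 : ContDiffOn ℝ ∞ (fun x => η (truncLE hNM x)) (truncLE hNM ⁻¹' O) :=
      hη.comp (truncLE hNM).contDiff.contDiffOn fun x hx => hx
    let L : ((Fin N → ℝ) [⋀^Fin k]→L[ℝ] ℝ) →L[ℝ] ((Fin M → ℝ) [⋀^Fin k]→L[ℝ] ℝ) :=
      ContinuousAlternatingMap.compContinuousLinearMapCLM (truncLE hNM)
    exact L.contDiff.comp_contDiffOn h1
  · intro w hw v
    rw [e w hw v]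
    rfl

theorem isForm_add {α β : PreForm U k} (hα : IsForm α) (hβ : IsForm β) : IsForm (α + β) := by
  intro z
  obtain ⟨N, h1⟩ := hα z
  obtain ⟨M, h2⟩ := hβ z
  obtain ⟨O, hO, hz, η, hη, e⟩ := isForm_raise z (le_max_left N M) h1
  obtain ⟨O', hO', hz', η', hη', e'⟩ := isForm_raise z (le_max_right N M) h2
  refine ⟨max N M, O ∩ O', hO.inter hO', ⟨hz, hz'⟩, η + η',
    (hη.mono Set.inter_subset_left).add (hη'.mono Set.inter_subset_right), fun w hw v => ?_⟩
  simp [e w hw.1 v, e' w hw.2 v]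

theorem wedge_add (α β : PreForm U k) (θ : PreForm U 1) :
    (α + β).wedge θ = α.wedge θ + β.wedge θ := by
  funext z v
  simp [wedge, add_mul, mul_add, Finset.sum_add_distrib]

theorem wedge_smul (c : ℝ) (α : PreForm U k) (θ : PreForm U 1) :
    (c • α).wedge θ = c • α.wedge θ := by
  funext z v
  simp only [wedge, Pi.smul_apply, smul_eq_mul, Finset.mul_sum]
  exact Finset.sum_congr rfl fun i _ => by ring

/-- Differentiability along all lines, which makes the exterior derivative additive. -/
def LineDiff (α : PreForm U k) : Prop :=
  ∀ (z : Frames U) (x : ℕ → ℝ) (v : Fin k → ℕ → ℝ),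
    DifferentiableAt ℝ (fun t : ℝ => α.extend v (z.1 + t • x)) 0

theorem eventually_mem (z : Frames U) (x : ℕ → ℝ) :
    ∀ᶠ t : ℝ in nhds 0, z.1 + t • x ∈ Frames U := by
  have h0 : Continuous fun t : ℝ => z.1 0 + t * x 0 := by fun_prop
  have h1 : Continuous fun t : ℝ => z.1 1 + t * x 1 := by fun_prop
  have e0 := h0.continuousAt.eventually_mem (x := 0) (s := (U : Set ℝ))
    (U.isOpen.mem_nhds (by simpa using z.2.1))
  have e1 := h1.continuousAt.eventually_ne (x := 0) (y := 0) (by simpa using z.2.2)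
  filter_upwards [e0, e1] with t h h'
  exact ⟨h, h'⟩

theorem extend_of_mem (α : PreForm U k) (v : Fin k → ℕ → ℝ) {w : ℕ → ℝ} (h : w ∈ Frames U) :
    α.extend v w = α ⟨w, h⟩ v := by
  simp [extend, h]

theorem lineDiff_of_isForm {α : PreForm U k} (h : IsForm α) : LineDiff α := by
  intro z x v
  obtain ⟨N, O, hO, hz, η, hη, e⟩ := h z
  have hc : Differentiable ℝ fun t : ℝ => trunc N z.1 + t • trunc N x := by fun_prop
  have hO' : ∀ᶠ t : ℝ in nhds 0, trunc N z.1 + t • trunc N x ∈ O :=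
    hc.continuous.continuousAt.eventually_mem (hO.mem_nhds (by simpa using hz))
  have hd : DifferentiableAt ℝ (fun t : ℝ => η (trunc N z.1 + t • trunc N x)) 0 := by
    refine DifferentiableAt.comp (𝕜 := ℝ) (0 : ℝ) (g := η) ?_ hc.differentiableAt
    refine (hη.differentiableOn (by simp)).differentiableAt (hO.mem_nhds ?_)
    simpa using hz
  have hd' : DifferentiableAt ℝ
      (fun t : ℝ => η (trunc N z.1 + t • trunc N x) (fun i => trunc N (v i))) 0 :=
    ((ContinuousAlternatingMap.apply ℝ (Fin N → ℝ) ℝ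
      (fun i => trunc N (v i))).differentiableAt).comp (0 : ℝ) hd
  refine hd'.congr_of_eventuallyEq ?_
  filter_upwards [hO', eventually_mem z x] with t h1 h2
  rw [extend_of_mem _ _ h2]
  exact e ⟨_, h2⟩ h1 v

theorem LineDiff.wedge {α : PreForm U k} {θ : PreForm U 1} (hα : LineDiff α)
    (hθ : LineDiff θ) : LineDiff (α.wedge θ) := by
  intro z x v
  have h : DifferentiableAt ℝ (fun t : ℝ => ∑ i : Fin (k + 1), (-1 : ℝ) ^ (k + (i : ℕ)) *
      (α.extend (i.removeNth v) (z.1 + t • x) * θ.extend (fun _ => v i) (z.1 + t • x))) 0 :=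
    DifferentiableAt.fun_sum fun i _ =>
      ((hα z x _).mul (hθ z x _)).const_mul _
  refine h.congr_of_eventuallyEq ?_
  filter_upwards [eventually_mem z x] with t ht
  simp [extend_of_mem _ _ ht, PreForm.wedge]

theorem lineDiff_canonicalForm_zero : LineDiff (canonicalForm U 0) := by
  intro z x v
  have h1 : z.1 1 ≠ 0 := z.2.2
  have h : DifferentiableAt ℝ (fun t : ℝ => -v 0 0 / (z.1 1 + t * x 1)) 0 := by
    refine DifferentiableAt.div (by fun_prop) (by fun_prop) (by simpa using h1)
  refine h.congr_of_eventuallyEq ?_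
  filter_upwards [eventually_mem z x] with t ht
  simp [extend_of_mem _ _ ht, canonicalForm_zero]

theorem lineDiff_canonicalForm_one : LineDiff (canonicalForm U 1) := by
  intro z x v
  have h1 : z.1 1 ≠ 0 := z.2.2
  have h : DifferentiableAt ℝ (fun t : ℝ => -v 0 1 / (z.1 1 + t * x 1) +
      (z.1 2 + t * x 2) / (z.1 1 + t * x 1) ^ 2 * v 0 0) 0 := by
    refine DifferentiableAt.add ?_ (DifferentiableAt.mul ?_ (by fun_prop))
    · exact DifferentiableAt.div (by fun_prop) (by fun_prop) (by simpa using h1)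
    · exact DifferentiableAt.div (by fun_prop) (by fun_prop) (by simpa using h1)
  refine h.congr_of_eventuallyEq ?_
  filter_upwards [eventually_mem z x] with t ht
  simp [extend_of_mem _ _ ht, canonicalForm_one]

theorem d_zero : (0 : PreForm U k).d = 0 := by
  have e : ∀ v, (0 : PreForm U k).extend v = fun _ => (0 : ℝ) := fun v => by
    funext w; simp [extend]
  funext z v
  simp [d, e, lineDeriv]

theorem d_smul (c : ℝ) (α : PreForm U k) : (c • α).d = c • α.d := by
  have e : ∀ v w, (c • α).extend v w = c * α.extend v w := fun v w => by
    by_cases h : w ∈ Frames U <;> simp [extend, h]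
  funext z v
  simp only [d, lineDeriv, e, Pi.smul_apply, smul_eq_mul, Finset.mul_sum,
    deriv_const_mul_field]
  exact Finset.sum_congr rfl fun i _ => by ring

theorem d_add {α β : PreForm U k} (hα : LineDiff α) (hβ : LineDiff β) :
    (α + β).d = α.d + β.d := by
  have e : ∀ v w, (α + β).extend v w = α.extend v w + β.extend v w := fun v w => by
    by_cases h : w ∈ Frames U <;> simp [extend, h]
  funext z v
  simp only [d, lineDeriv, e, Pi.add_apply, ← Finset.sum_add_distrib]
  refine Finset.sum_congr rfl fun i _ => ?_
  rw [deriv_fun_add (hα z _ _) (hβ z _ _), mul_add]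

end PreForm

/-! ### The relative complex and its third cohomology -/

namespace D1Space

variable {X : Type*} (D : D1Space X)

/-- A form of degree `k` (not yet smooth or compatible) on `S(U)` for every chart of `X`. -/
abbrev Family (k : ℕ) : Type _ := ∀ c : D.charts, PreForm c.1.dom k

/-- `Ω^k(S(X))`: for every chart `U → X` a smooth `k`-form on `S(U)`, such that for every morphism
of charts `m` the form on the source is the pull-back of the form on the target under `S(m)`. -/
def forms (k : ℕ) : Submodule ℝ (D.Family k) where
  carrier := {α | (∀ c, IsForm (α c)) ∧
    ∀ (c₁ c₂ : D.charts) (m : ℝ → ℝ) (hm : LineChart.IsMorphism c₁.1 c₂.1 m)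
      (z : Frames c₁.1.dom) (v : Fin k → ℕ → ℝ),
      α c₁ z v = α c₂ (framesMap hm.etale z) (fun i => framesTangent m z (v i))}
  zero_mem' := ⟨fun _ => PreForm.isForm_zero, fun _ _ _ _ _ _ => rfl⟩
  add_mem' := by
    rintro α β ⟨h1, h2⟩ ⟨h3, h4⟩
    refine ⟨fun c => PreForm.isForm_add (h1 c) (h3 c), fun c₁ c₂ m hm z v => ?_⟩
    simp only [Pi.add_apply]
    rw [h2 c₁ c₂ m hm z v, h4 c₁ c₂ m hm z v]
  smul_mem' := by
    rintro r α ⟨h1, h2⟩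
    refine ⟨fun c => PreForm.isForm_smul r (h1 c), fun c₁ c₂ m hm z v => ?_⟩
    simp only [Pi.smul_apply]
    rw [h2 c₁ c₂ m hm z v]

/-- The canonical form `θ_r` on `S(X)`. -/
noncomputable def theta (r : ℕ) : D.Family 1 := fun c => canonicalForm c.1.dom r

/-- The map `β ↦ β ∧ θ`. -/
def wedgeRight {k : ℕ} (θ : D.Family 1) : D.Family k →ₗ[ℝ] D.Family (k + 1) where
  toFun β := fun c => (β c).wedge (θ c)
  map_add' _ _ := funext fun _ => PreForm.wedge_add _ _ _
  map_smul' _ _ := funext fun _ => PreForm.wedge_smul _ _ _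

/-- The space `Ω^k(S(X)) ∧ θ₁ ∧ θ₀` of forms of degree `k + 2`. -/
noncomputable def relForms (k : ℕ) : Submodule ℝ (D.Family (k + 2)) :=
  (D.forms k).map (D.wedgeRight (D.theta 0) ∘ₗ D.wedgeRight (D.theta 1))

/-- The exterior derivative, chart by chart. -/
noncomputable def d {k : ℕ} (α : D.Family k) : D.Family (k + 1) := fun c => (α c).d

theorem lineDiff_of_mem_relForms {k : ℕ} {α : D.Family (k + 2)} (h : α ∈ D.relForms k)
    (c : D.charts) : (α c).LineDiff := by
  obtain ⟨β, hβ, rfl⟩ := h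
  exact ((PreForm.lineDiff_of_isForm (hβ.1 c)).wedge PreForm.lineDiff_canonicalForm_one).wedge
    PreForm.lineDiff_canonicalForm_zero

theorem d_zero {k : ℕ} : D.d (0 : D.Family k) = 0 := funext fun _ => PreForm.d_zero

theorem d_smul {k : ℕ} (r : ℝ) (α : D.Family k) : D.d (r • α) = r • D.d α :=
  funext fun _ => PreForm.d_smul _ _

theorem d_add {k : ℕ} {α β : D.Family (k + 2)} (hα : α ∈ D.relForms k) (hβ : β ∈ D.relForms k) :
    D.d (α + β) = D.d α + D.d β :=
  funext fun c => PreForm.d_add (D.lineDiff_of_mem_relForms hα c) (D.lineDiff_of_mem_relForms hβ c)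

/-- The cocycles of degree `3` of the complex `Ω^{*-2}(S(X)) ∧ θ₁ ∧ θ₀`. -/
noncomputable def cocycles : Submodule ℝ (D.Family 3) where
  carrier := {α | α ∈ D.relForms 1 ∧ D.d α = 0}
  zero_mem' := ⟨(D.relForms 1).zero_mem, D.d_zero⟩
  add_mem' := by
    rintro α β ⟨h1, h2⟩ ⟨h3, h4⟩
    exact ⟨(D.relForms 1).add_mem h1 h3, by rw [D.d_add h1 h3, h2, h4, add_zero]⟩
  smul_mem' := by
    rintro r α ⟨h1, h2⟩
    exact ⟨(D.relForms 1).smul_mem r h1, by rw [D.d_smul, h2, smul_zero]⟩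

/-- The coboundaries of degree `3` of the complex `Ω^{*-2}(S(X)) ∧ θ₁ ∧ θ₀`. -/
noncomputable def coboundaries : Submodule ℝ (D.Family 3) where
  carrier := {α | ∃ γ ∈ D.relForms 0, D.d γ = α}
  zero_mem' := ⟨0, (D.relForms 0).zero_mem, D.d_zero⟩
  add_mem' := by
    rintro _ _ ⟨α, h1, rfl⟩ ⟨β, h2, rfl⟩
    exact ⟨α + β, (D.relForms 0).add_mem h1 h2, D.d_add h1 h2⟩
  smul_mem' := by
    rintro r _ ⟨α, h1, rfl⟩
    exact ⟨r • α, (D.relForms 0).smul_mem r h1, D.d_smul r α⟩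

/-- The cohomology space `H³_{θ₁∧θ₀}(S(X))`. -/
abbrev RelH3 : Type _ := D.cocycles ⧸ D.coboundaries.submoduleOf D.cocycles

/-- The class in `H³_{θ₁∧θ₀}(S(X))` of a cocycle. -/
noncomputable def relClass (α : D.Family 3) (h : α ∈ D.cocycles) : D.RelH3 :=
  Submodule.Quotient.mk ⟨α, h⟩

/-- The form `θ₃ ∧ θ₁ ∧ θ₀` on `S(X)`. -/
noncomputable def theta310 : D.Family 3 :=
  D.wedgeRight (D.theta 0) (D.wedgeRight (D.theta 1) (D.theta 3))

end D1Space

/-! ### Projective connections -/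

/-- The Schwarzian derivative. -/
noncomputable def schwarzian (φ : ℝ → ℝ) (w : ℝ) : ℝ :=
  iteratedDeriv 3 φ w / deriv φ w - 3 / 2 * ((iteratedDeriv 2 φ w) ^ 2 / (deriv φ w) ^ 2)

namespace D1Space

variable {X : Type*} (D : D1Space X)

/-- `q` is a projective connection on `X`: a smooth function of the coordinate of every chart, with
the Schwarzian transformation rule under all morphisms of charts. -/
structure IsProjectiveConnection (q : D.charts → ℝ → ℝ) : Prop where
  smooth : ∀ c, ContDiffOn ℝ ∞ (q c) c.1.dom
  rule : ∀ (c₁ c₂ : D.charts) (φ : ℝ → ℝ), LineChart.IsMorphism c₁.1 c₂.1 φ → ∀ w ∈ c₁.1.dom,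
    q c₂ (φ w) * (deriv φ w) ^ 2 = q c₁ w - schwarzian φ w

/-- `S₁(U)`: the frames of first order, with coordinates `(y₀, y₁)`. -/
def _root_.Frames₁ (U : Opens ℝ) : Set (ℝ × ℝ) := {y | y.1 ∈ U ∧ y.2 ≠ 0}

/-- `q` assigns to every chart a smooth function of `(y₀, y₁)` on the frames of first order, with
the Schwarzian transformation rule under all morphisms of charts. -/
structure IsFrameProjectiveConnection (q : D.charts → ℝ × ℝ → ℝ) : Prop where
  smooth : ∀ c, ContDiffOn ℝ ∞ (q c) (Frames₁ c.1.dom)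
  rule : ∀ (c₁ c₂ : D.charts) (φ : ℝ → ℝ), LineChart.IsMorphism c₁.1 c₂.1 φ →
    ∀ y₀ y₁ : ℝ, (y₀, y₁) ∈ Frames₁ c₁.1.dom →
      q c₂ (φ y₀, deriv φ y₀ * y₁) * (deriv φ y₀) ^ 2 = q c₁ (y₀, y₁) - schwarzian φ y₀

end D1Space

/-! ### Prolongations of low order -/

/-! Write `S = z₃/z₁ - (3/2)(z₂/z₁)²` for the Schwarzian of a frame (`frameSchwarzian`). On one
chart `θ₁ ∧ θ₀ = dz₁ ∧ dz₀ / z₁²` is closed, and `θ₃ ≡ -dS` modulo `dz₀, dz₁`. Hence `θ₃ ∧ θ₁ ∧ θ₀ =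
-dS ∧ θ₁ ∧ θ₀`: it is closed, and `f θ₁ ∧ θ₀` is a primitive exactly when `d(f + S) ∧ dz₁ ∧ dz₀ =
0`, that is, when `f + S` depends on `(z₀, z₁)` alone. The two directions are
`d_connectionPrimitive` and `add_frameSchwarzian_eq_of_d_eq`.

So primitives on a chart have the form `f = -S - z₁² q(z₀, z₁)`. The chain rule for the Schwarzian
(`frameSchwarzian_prolong`) adds `z₁² S(φ)` to `S` under a change of chart, so `f` is invariant
precisely when `q` obeys the Schwarzian rule. Triviality of the class asks for an invariant `f`,
since the cochains of degree 2 are the `f θ₁ ∧ θ₀` with `f ∈ Ω⁰(S(X))`. That the form is itself a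
cochain rests on the invariance of `θ₃`, checked on 4-jets (`canonicalForm_three_framesMap`). A
projective connection is a `q` independent of `y₁`. -/

theorem contDiffOn_iteratedDeriv {U : Set ℝ} (hU : IsOpen U) {φ : ℝ → ℝ}
    (hφ : ContDiffOn ℝ ∞ φ U) (k : ℕ) : ContDiffOn ℝ ∞ (iteratedDeriv k φ) U := by
  induction k with
  | zero => simpa using hφ
  | succ k ih =>
    rw [iteratedDeriv_succ]
    exact ((contDiffOn_infty_iff_deriv_of_isOpen hU).1 ih).2

theorem hasDerivAt_iteratedDeriv_of_contDiffOn {U : Set ℝ} (hU : IsOpen U) {φ : ℝ → ℝ}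
    (hφ : ContDiffOn ℝ ∞ φ U) (k : ℕ) {u : ℝ} (hu : u ∈ U) :
    HasDerivAt (iteratedDeriv k φ) (iteratedDeriv (k + 1) φ u) u := by
  rw [iteratedDeriv_succ]
  refine DifferentiableAt.hasDerivAt ?_
  exact ((contDiffOn_iteratedDeriv hU hφ k).contDiffAt (hU.mem_nhds hu)).differentiableAt
    (by simp)

theorem iteratedDeriv_taylor_zero (z : ℕ → ℝ) {n j : ℕ} (hj : j ≤ n) :
    iteratedDeriv j (fun t : ℝ => ∑ p ∈ Finset.range (n + 1), z p / p.factorial * t ^ p) 0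
      = z j := by
  rw [iteratedDeriv_fun_sum (fun i _ => by fun_prop)]
  simp_rw [iteratedDeriv_const_mul_field, iteratedDeriv_fun_pow_zero]
  rw [Finset.sum_eq_single j]
  · rw [if_pos rfl, div_mul_cancel₀ _ (by exact_mod_cast j.factorial_ne_zero)]
  · intro i _ hi
    rw [if_neg hi.symm, Nat.cast_zero, mul_zero]
  · intro h
    exact absurd (Finset.mem_range.2 (by omega)) h

section Composition

variable {U : Set ℝ} {φ p : ℝ → ℝ}

/-- On an open set an identity between functions may be differentiated; this is the induction step
for the chain rule below. -/
theorem eqOn_iteratedDeriv_succ {g g' h : ℝ → ℝ} {W : Set ℝ} (hW : IsOpen W) {n : ℕ}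
    (e : Set.EqOn (iteratedDeriv n g) h W) (hd : ∀ t ∈ W, HasDerivAt h (g' t) t) :
    Set.EqOn (iteratedDeriv (n + 1) g) g' W := fun t ht => by
  rw [iteratedDeriv_succ, (Filter.eventuallyEq_of_mem (hW.mem_nhds ht) e).deriv_eq]
  exact (hd t ht).deriv

theorem hasDerivAt_iteratedDeriv_comp (hU : IsOpen U) (hφ : ContDiffOn ℝ ∞ φ U)
    (hp : ContDiff ℝ ∞ p) (k : ℕ) {t : ℝ} (ht : p t ∈ U) :
    HasDerivAt (fun s => iteratedDeriv k φ (p s))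
      (iteratedDeriv (k + 1) φ (p t) * iteratedDeriv 1 p t) t := by
  have h := hasDerivAt_iteratedDeriv_of_contDiffOn isOpen_univ hp.contDiffOn 0 (Set.mem_univ t)
  rw [iteratedDeriv_zero] at h
  exact (hasDerivAt_iteratedDeriv_of_contDiffOn hU hφ k ht).comp t h

/-- Faà di Bruno's formula, each order by differentiating the previous one; hence identities on all
of `W` rather than at a point. Order 4 is needed because `θ₃` involves `z₄`. -/
theorem iteratedDeriv_comp_low (hU : IsOpen U) (hφ : ContDiffOn ℝ ∞ φ U)
    (hp : ContDiff ℝ ∞ p) :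
    let W := p ⁻¹' U
    let a := fun k t => iteratedDeriv k φ (p t)
    let b := fun k t => iteratedDeriv k p t
    Set.EqOn (iteratedDeriv 2 fun t => φ (p t))
      (fun t => a 2 t * b 1 t ^ 2 + a 1 t * b 2 t) W ∧
    Set.EqOn (iteratedDeriv 3 fun t => φ (p t))
      (fun t => a 3 t * b 1 t ^ 3 + 3 * a 2 t * b 1 t * b 2 t + a 1 t * b 3 t) W ∧
    Set.EqOn (iteratedDeriv 4 fun t => φ (p t))
      (fun t => a 4 t * b 1 t ^ 4 + 6 * a 3 t * b 1 t ^ 2 * b 2 t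
        + a 2 t * (3 * b 2 t ^ 2 + 4 * b 1 t * b 3 t) + a 1 t * b 4 t) W := by
  intro W a b
  have hW : IsOpen W := hU.preimage hp.continuous
  have ha : ∀ k, ∀ t ∈ W, HasDerivAt (a k) (a (k + 1) t * b 1 t) t := fun k t ht =>
    hasDerivAt_iteratedDeriv_comp hU hφ hp k ht
  have hb : ∀ k t, HasDerivAt (b k) (b (k + 1) t) t := fun k t =>
    hasDerivAt_iteratedDeriv_of_contDiffOn isOpen_univ hp.contDiffOn k (Set.mem_univ t)
  have e0 : Set.EqOn (iteratedDeriv 0 fun t => φ (p t)) (a 0) W := fun t _ => by simp [a]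
  have e1 := eqOn_iteratedDeriv_succ hW e0 (ha 0)
  have e2 : Set.EqOn (iteratedDeriv 2 fun t => φ (p t))
      (fun t => a 2 t * b 1 t ^ 2 + a 1 t * b 2 t) W :=
    eqOn_iteratedDeriv_succ hW e1 fun t ht =>
      ((ha 1 t ht).mul (hb 1 t)).congr_deriv (by ring)
  have e3 : Set.EqOn (iteratedDeriv 3 fun t => φ (p t))
      (fun t => a 3 t * b 1 t ^ 3 + 3 * a 2 t * b 1 t * b 2 t + a 1 t * b 3 t) W :=
    eqOn_iteratedDeriv_succ hW e2 fun t ht =>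
      (((ha 2 t ht).mul ((hb 1 t).fun_pow 2)).add ((ha 1 t ht).mul (hb 2 t))).congr_deriv
        (by push_cast; ring)
  refine ⟨e2, e3, eqOn_iteratedDeriv_succ hW e3 fun t ht => ?_⟩
  exact ((((ha 3 t ht).mul ((hb 1 t).fun_pow 3)).add
    ((((ha 2 t ht).const_mul 3).mul (hb 1 t)).mul (hb 2 t))).add
    ((ha 1 t ht).mul (hb 3 t))).congr_deriv (by simp only [Pi.mul_apply]; push_cast; ring)

end Composition

section Prolong

variable {U : Set ℝ} {φ : ℝ → ℝ} {z : ℕ → ℝ}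

theorem contDiff_taylor (z : ℕ → ℝ) (n : ℕ) :
    ContDiff ℝ ∞ fun t : ℝ => ∑ p ∈ Finset.range n, z p / p.factorial * t ^ p := by
  fun_prop

theorem taylor_apply_zero (z : ℕ → ℝ) (n : ℕ) :
    ∑ p ∈ Finset.range (n + 1), z p / p.factorial * (0 : ℝ) ^ p = z 0 := by
  simpa using iteratedDeriv_taylor_zero z (Nat.zero_le n)

theorem prolong_two (hU : IsOpen U) (hφ : ContDiffOn ℝ ∞ φ U) (hz : z 0 ∈ U) :
    prolong φ z 2 = iteratedDeriv 2 φ (z 0) * z 1 ^ 2 + iteratedDeriv 1 φ (z 0) * z 2 := by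
  have h0 := taylor_apply_zero z 2
  -- `contDiff_taylor` counts terms: 3 terms give the Taylor polynomial of degree 2 used by
  -- `prolong`.
  have h := (iteratedDeriv_comp_low hU hφ (contDiff_taylor z 3)).1 (x := 0)
    (by simpa only [Set.mem_preimage, h0] using hz)
  simp only [h0] at h
  rw [iteratedDeriv_taylor_zero z (by norm_num), iteratedDeriv_taylor_zero z (by norm_num)] at h
  exact h

theorem prolong_three (hU : IsOpen U) (hφ : ContDiffOn ℝ ∞ φ U) (hz : z 0 ∈ U) :
    prolong φ z 3 = iteratedDeriv 3 φ (z 0) * z 1 ^ 3 + 3 * iteratedDeriv 2 φ (z 0) * z 1 * z 2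
      + iteratedDeriv 1 φ (z 0) * z 3 := by
  have h0 := taylor_apply_zero z 3
  have h := (iteratedDeriv_comp_low hU hφ (contDiff_taylor z 4)).2.1 (x := 0)
    (by simpa only [Set.mem_preimage, h0] using hz)
  simp only [h0] at h
  rw [iteratedDeriv_taylor_zero z (by norm_num), iteratedDeriv_taylor_zero z (by norm_num),
    iteratedDeriv_taylor_zero z (by norm_num)] at h
  exact h

theorem prolong_four (hU : IsOpen U) (hφ : ContDiffOn ℝ ∞ φ U) (hz : z 0 ∈ U) :
    prolong φ z 4 = iteratedDeriv 4 φ (z 0) * z 1 ^ 4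
      + 6 * iteratedDeriv 3 φ (z 0) * z 1 ^ 2 * z 2
      + iteratedDeriv 2 φ (z 0) * (3 * z 2 ^ 2 + 4 * z 1 * z 3)
      + iteratedDeriv 1 φ (z 0) * z 4 := by
  have h0 := taylor_apply_zero z 4
  have h := (iteratedDeriv_comp_low hU hφ (contDiff_taylor z 5)).2.2 (x := 0)
    (by simpa only [Set.mem_preimage, h0] using hz)
  simp only [h0] at h
  rw [iteratedDeriv_taylor_zero z (by norm_num), iteratedDeriv_taylor_zero z (by norm_num),
    iteratedDeriv_taylor_zero z (by norm_num), iteratedDeriv_taylor_zero z (by norm_num)] at h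
  exact h

theorem prolong_one' (hU : IsOpen U) (hφ : ContDiffOn ℝ ∞ φ U) (hz : z 0 ∈ U) :
    prolong φ z 1 = iteratedDeriv 1 φ (z 0) * z 1 := by
  rw [iteratedDeriv_one]
  exact prolong_one φ z ((hφ.contDiffAt (hU.mem_nhds hz)).differentiableAt (by simp))

/-! ### The differential of a prolongation -/

/-- A short line through `z` keeps its coordinate `0` in `U`, so a formula for `prolong` valid over
`U` suffices for the differential. -/
theorem framesTangent_eq (hU : IsOpen U) (hz : z 0 ∈ U) (v : ℕ → ℝ) (n : ℕ)
    {F : (ℕ → ℝ) → ℝ} {F' : ℝ} (hF : ∀ w : ℕ → ℝ, w 0 ∈ U → prolong φ w n = F w)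
    (hd : HasDerivAt (fun t : ℝ => F (z + t • v)) F' 0) : framesTangent φ z v n = F' := by
  have hc : Continuous fun t : ℝ => z 0 + t * v 0 := by fun_prop
  have e0 := hc.continuousAt.eventually_mem (x := 0) (hU.mem_nhds (by simpa using hz))
  have e : (fun t : ℝ => prolong φ (z + t • v) n) =ᶠ[nhds 0] fun t => F (z + t • v) := by
    filter_upwards [e0] with t ht using hF _ ht
  exact (hd.congr_of_eventuallyEq e).deriv

theorem hasDerivAt_line_coord (z v : ℕ → ℝ) (n : ℕ) :
    HasDerivAt (fun t : ℝ => (z + t • v) n) (v n) 0 := by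
  simpa using ((hasDerivAt_id (0 : ℝ)).mul_const (v n)).const_add (z n)

theorem hasDerivAt_line_iteratedDeriv (hU : IsOpen U) (hφ : ContDiffOn ℝ ∞ φ U) (hz : z 0 ∈ U)
    (v : ℕ → ℝ) (k : ℕ) :
    HasDerivAt (fun t : ℝ => iteratedDeriv k φ ((z + t • v) 0))
      (iteratedDeriv (k + 1) φ (z 0) * v 0) 0 := by
  have h := hasDerivAt_iteratedDeriv_of_contDiffOn hU hφ k hz
  exact HasDerivAt.comp (0 : ℝ) (h₂ := iteratedDeriv k φ) (by simpa using h)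
    (hasDerivAt_line_coord z v 0)

theorem framesTangent_zero (hU : IsOpen U) (hφ : ContDiffOn ℝ ∞ φ U) (hz : z 0 ∈ U)
    (v : ℕ → ℝ) : framesTangent φ z v 0 = iteratedDeriv 1 φ (z 0) * v 0 := by
  refine framesTangent_eq hU hz v 0 (fun w _ => prolong_zero φ w) ?_
  simpa using hasDerivAt_line_iteratedDeriv hU hφ hz v 0

theorem framesTangent_one (hU : IsOpen U) (hφ : ContDiffOn ℝ ∞ φ U) (hz : z 0 ∈ U)
    (v : ℕ → ℝ) : framesTangent φ z v 1 =
      iteratedDeriv 2 φ (z 0) * v 0 * z 1 + iteratedDeriv 1 φ (z 0) * v 1 := by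
  refine framesTangent_eq hU hz v 1 (fun w hw => prolong_one' hU hφ hw) ?_
  have ha := hasDerivAt_line_iteratedDeriv hU hφ hz v
  have hb := hasDerivAt_line_coord z v
  exact ((ha 1).mul (hb 1)).congr_deriv (by simp)

theorem framesTangent_two (hU : IsOpen U) (hφ : ContDiffOn ℝ ∞ φ U) (hz : z 0 ∈ U)
    (v : ℕ → ℝ) : framesTangent φ z v 2 =
      iteratedDeriv 3 φ (z 0) * v 0 * z 1 ^ 2 + iteratedDeriv 2 φ (z 0) * (2 * z 1 * v 1)
        + (iteratedDeriv 2 φ (z 0) * v 0 * z 2 + iteratedDeriv 1 φ (z 0) * v 2) := by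
  refine framesTangent_eq hU hz v 2 (fun w hw => prolong_two hU hφ hw) ?_
  have ha := hasDerivAt_line_iteratedDeriv hU hφ hz v
  have hb := hasDerivAt_line_coord z v
  exact (((ha 2).mul ((hb 1).fun_pow 2)).add ((ha 1).mul (hb 2))).congr_deriv (by simp)

theorem framesTangent_three (hU : IsOpen U) (hφ : ContDiffOn ℝ ∞ φ U) (hz : z 0 ∈ U)
    (v : ℕ → ℝ) : framesTangent φ z v 3 =
      iteratedDeriv 4 φ (z 0) * v 0 * z 1 ^ 3 + iteratedDeriv 3 φ (z 0) * (3 * z 1 ^ 2 * v 1)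
        + ((3 * (iteratedDeriv 3 φ (z 0) * v 0) * z 1 + 3 * iteratedDeriv 2 φ (z 0) * v 1) * z 2
          + 3 * iteratedDeriv 2 φ (z 0) * z 1 * v 2)
        + (iteratedDeriv 2 φ (z 0) * v 0 * z 3 + iteratedDeriv 1 φ (z 0) * v 3) := by
  refine framesTangent_eq hU hz v 3 (fun w hw => prolong_three hU hφ hw) ?_
  have ha := hasDerivAt_line_iteratedDeriv hU hφ hz v
  have hb := hasDerivAt_line_coord z v
  exact ((((ha 3).mul ((hb 1).fun_pow 3)).add
    ((((ha 2).const_mul 3).mul (hb 1)).mul (hb 2))).add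
    ((ha 1).mul (hb 3))).congr_deriv (by simp)

end Prolong

/-! ### Invariance of `θ₃` under étale maps -/

theorem canonicalForm_three_apply (U : Opens ℝ) (z : Frames U) (v : Fin 1 → ℕ → ℝ) :
    canonicalForm U 3 z v =
      (z.1 4 / z.1 1 ^ 2 + 6 * z.1 2 ^ 3 / z.1 1 ^ 4 - 6 * z.1 2 * z.1 3 / z.1 1 ^ 3) * v 0 0
      + (3 * z.1 3 / z.1 1 ^ 2 - 6 * z.1 2 ^ 2 / z.1 1 ^ 3) * v 0 1
      + 3 * z.1 2 / z.1 1 ^ 2 * v 0 2 + -(1 / z.1 1) * v 0 3 := by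
  have h1 : z.1 1 ≠ 0 := z.2.2
  rw [canonicalForm_three U z v _ _ (fun _ => rfl) (fun _ => rfl)]
  norm_num
  field_simp
  ring

/-- Conceptually, `k₀⁻¹ ∘ k_u` does not change when `k₀` and `k_u` are both composed with `m`. The
proof verifies this in jet coordinates, where the higher derivatives of `m` cancel. -/
theorem canonicalForm_three_framesMap {U V : Opens ℝ} {m : ℝ → ℝ} (hm : IsEtale U V m)
    (z : Frames U) (v : Fin 1 → ℕ → ℝ) :
    canonicalForm V 3 (framesMap hm z) (fun i => framesTangent m z (v i)) =
      canonicalForm U 3 z v := by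
  have h1 : z.1 1 ≠ 0 := z.2.2
  have hz : z.1 0 ∈ (U : Set ℝ) := z.2.1
  have hr : iteratedDeriv 1 m (z.1 0) ≠ 0 := by
    rw [iteratedDeriv_one]; exact hm.regular _ hz
  rw [canonicalForm_three_apply, canonicalForm_three_apply]
  simp only [framesMap, prolong_one' U.isOpen hm.smooth hz, prolong_two U.isOpen hm.smooth hz,
    prolong_three U.isOpen hm.smooth hz, prolong_four U.isOpen hm.smooth hz,
    framesTangent_zero U.isOpen hm.smooth hz, framesTangent_one U.isOpen hm.smooth hz,
    framesTangent_two U.isOpen hm.smooth hz, framesTangent_three U.isOpen hm.smooth hz]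
  field_simp
  ring

/-! ### The forms `θ₃ ∧ θ₁ ∧ θ₀` and `f θ₁ ∧ θ₀` on one chart -/

namespace PreForm

variable {U : Opens ℝ} {k : ℕ}

theorem lineDeriv_extend {α : PreForm U k} {v : Fin k → ℕ → ℝ} {F : (ℕ → ℝ) → ℝ}
    (hF : ∀ w : Frames U, α w v = F w) (z : Frames U) (x : ℕ → ℝ) {c : ℝ}
    (hd : HasDerivAt (fun t : ℝ => F (z.1 + t • x)) c 0) :
    lineDeriv ℝ (α.extend v) z x = c := by
  refine (hd.congr_of_eventuallyEq ?_).deriv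
  filter_upwards [eventually_mem z x] with t ht
  rw [extend_of_mem _ _ ht, hF]

end PreForm

/-- The minor of coordinates `a`, `b` of two vectors. -/
def minor₂ (a b : ℕ) (v : Fin 2 → ℕ → ℝ) : ℝ := v 0 a * v 1 b - v 0 b * v 1 a

/-- The minor of coordinates `a`, `b`, `c` of three vectors. -/
def minor₃ (a b c : ℕ) (v : Fin 3 → ℕ → ℝ) : ℝ :=
  v 0 a * (v 1 b * v 2 c - v 1 c * v 2 b) - v 1 a * (v 0 b * v 2 c - v 0 c * v 2 b)
    + v 2 a * (v 0 b * v 1 c - v 0 c * v 1 b)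

/-- The factor `θ₁ ∧ θ₀` kills the `dz₀` and `dz₁` terms of `θ₃`, and with them `z₄`; what survives
of `θ₃` agrees with `-dS`. -/
theorem theta310_apply (U : Opens ℝ) (z : Frames U) (v : Fin 3 → ℕ → ℝ) :
    ((canonicalForm U 3).wedge (canonicalForm U 1)).wedge (canonicalForm U 0) z v =
      3 * z.1 2 / z.1 1 ^ 4 * minor₃ 2 1 0 v - 1 / z.1 1 ^ 3 * minor₃ 3 1 0 v := by
  have h1 : z.1 1 ≠ 0 := z.2.2
  simp only [PreForm.wedge, Fin.sum_univ_succ, Fin.sum_univ_zero, canonicalForm_zero,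
    canonicalForm_one, canonicalForm_three_apply, Fin.removeNth_apply, minor₃]
  simp [Fin.succAbove, Fin.lt_def]
  field_simp
  ring

theorem wedge_theta10_apply {U : Opens ℝ} (f : PreForm U 0) (z : Frames U)
    (v : Fin 2 → ℕ → ℝ) :
    (f.wedge (canonicalForm U 1)).wedge (canonicalForm U 0) z v =
      f z ![] / z.1 1 ^ 2 * minor₂ 1 0 v := by
  have h1 : z.1 1 ≠ 0 := z.2.2
  have e : ∀ u : Fin 0 → ℕ → ℝ, f z u = f z ![] := fun u => by rw [Subsingleton.elim u ![]]
  simp only [PreForm.wedge, Fin.sum_univ_succ, Fin.sum_univ_zero, canonicalForm_zero,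
    canonicalForm_one, e, Fin.removeNth_apply, minor₂]
  simp [Fin.succAbove]
  field_simp
  ring

/-- The coefficient of `dz₂ ∧ dz₁ ∧ dz₀` involves only `z₁, z₂`, that of `dz₃ ∧ dz₁ ∧ dz₀` only
`z₁`, so every term of the differential repeats a factor. -/
theorem d_theta310 (U : Opens ℝ) :
    (((canonicalForm U 3).wedge (canonicalForm U 1)).wedge (canonicalForm U 0)).d = 0 := by
  funext z v
  have h1 : z.1 1 ≠ 0 := z.2.2
  have key : ∀ (x : ℕ → ℝ) (u : Fin 3 → ℕ → ℝ), lineDeriv ℝ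
      ((((canonicalForm U 3).wedge (canonicalForm U 1)).wedge (canonicalForm U 0)).extend u) z x =
      (3 * x 2 / z.1 1 ^ 4 - 12 * z.1 2 * x 1 / z.1 1 ^ 5) * minor₃ 2 1 0 u
        + 3 * x 1 / z.1 1 ^ 4 * minor₃ 3 1 0 u := by
    intro x u
    refine PreForm.lineDeriv_extend (F := fun w : ℕ → ℝ =>
      3 * w 2 / w 1 ^ 4 * minor₃ 2 1 0 u - 1 / w 1 ^ 3 * minor₃ 3 1 0 u)
      (fun w => theta310_apply U w u) z x ?_
    have hb := hasDerivAt_line_coord z.1 x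
    have h10 : (z.1 + (0 : ℝ) • x) 1 ≠ 0 := by simpa using h1
    refine (((((hb 2).const_mul 3).fun_div ((hb 1).fun_pow 4) (pow_ne_zero _ h10)).mul_const
      (minor₃ 2 1 0 u)).fun_sub (((hasDerivAt_const (0 : ℝ) (1 : ℝ)).fun_div ((hb 1).fun_pow 3)
      (pow_ne_zero _ h10)).mul_const (minor₃ 3 1 0 u))).congr_deriv ?_
    simp only [zero_smul, add_zero]
    field_simp
    push_cast
    ring
  simp only [PreForm.d, key, Fin.sum_univ_succ, Fin.sum_univ_zero, Fin.removeNth_apply, minor₃,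
    Pi.zero_apply]
  simp [Fin.succAbove, Fin.lt_def]
  field_simp
  ring

/-- This is `df ∧ θ₁ ∧ θ₀`, because `dz₁ ∧ dz₀ / z₁²` is closed. Only the derivatives of `f` along
the three vectors are needed. -/
theorem d_wedge_theta10 {U : Opens ℝ} (f : PreForm U 0) (z : Frames U) (v : Fin 3 → ℕ → ℝ)
    (c : Fin 3 → ℝ)
    (hc : ∀ i, HasDerivAt (fun t : ℝ => f.extend ![] (z.1 + t • v i)) (c i) 0) :
    ((f.wedge (canonicalForm U 1)).wedge (canonicalForm U 0)).d z v =
      (c 0 * minor₂ 1 0 ![v 1, v 2] - c 1 * minor₂ 1 0 ![v 0, v 2]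
        + c 2 * minor₂ 1 0 ![v 0, v 1]) / z.1 1 ^ 2 := by
  have h1 : z.1 1 ≠ 0 := z.2.2
  have key : ∀ (i : Fin 3) (u : Fin 2 → ℕ → ℝ), lineDeriv ℝ
      (((f.wedge (canonicalForm U 1)).wedge (canonicalForm U 0)).extend u) z (v i) =
      (c i / z.1 1 ^ 2 - 2 * f z ![] * v i 1 / z.1 1 ^ 3) * minor₂ 1 0 u := by
    intro i u
    refine PreForm.lineDeriv_extend (F := fun w : ℕ → ℝ =>
      f.extend ![] w / w 1 ^ 2 * minor₂ 1 0 u)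
      (fun w => by rw [wedge_theta10_apply, PreForm.extend_of_mem _ _ w.2]) z (v i) ?_
    have hb := hasDerivAt_line_coord z.1 (v i)
    have h10 : (z.1 + (0 : ℝ) • v i) 1 ≠ 0 := by simpa using h1
    refine (((hc i).fun_div ((hb 1).fun_pow 2) (pow_ne_zero _ h10)).mul_const
      (minor₂ 1 0 u)).congr_deriv ?_
    simp only [zero_smul, add_zero, PreForm.extend_of_mem f ![] z.2]
    field_simp
    push_cast
    ring
  simp only [PreForm.d, key, Fin.sum_univ_succ, Fin.sum_univ_zero, Fin.removeNth_apply, minor₂]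
  simp [Fin.succAbove, Fin.lt_def]
  field_simp
  ring

/-! ### The Schwarzian derivative as a function of the frame -/

/-- The Schwarzian derivative at `0` of a map with jet `z`. -/
noncomputable def frameSchwarzian (z : ℕ → ℝ) : ℝ := z 3 / z 1 - 3 / 2 * (z 2 / z 1) ^ 2

theorem hasDerivAt_line_frameSchwarzian {z : ℕ → ℝ} (h1 : z 1 ≠ 0) (x : ℕ → ℝ) :
    HasDerivAt (fun t : ℝ => frameSchwarzian (z + t • x))
      (x 3 / z 1 - z 3 * x 1 / z 1 ^ 2 - 3 * z 2 * x 2 / z 1 ^ 2 + 3 * z 2 ^ 2 * x 1 / z 1 ^ 3)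
      0 := by
  have hb := hasDerivAt_line_coord z x
  have h10 : (z + (0 : ℝ) • x) 1 ≠ 0 := by simpa using h1
  refine (((hb 3).fun_div (hb 1) h10).fun_sub
    ((((hb 2).fun_div (hb 1) h10).fun_pow 2).const_mul (3 / 2))).congr_deriv ?_
  norm_num
  field_simp
  ring

/-- The cocycle rule `S(m ∘ k) = S(k) + (k')² S(m)`, the source of the Schwarzian in the
transformation rule for `q`. -/
theorem frameSchwarzian_prolong {U V : Opens ℝ} {m : ℝ → ℝ} (hm : IsEtale U V m)
    (z : Frames U) :
    frameSchwarzian (prolong m z) = frameSchwarzian z.1 + z.1 1 ^ 2 * schwarzian m (z.1 0) := by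
  have h1 : z.1 1 ≠ 0 := z.2.2
  have hz : z.1 0 ∈ (U : Set ℝ) := z.2.1
  have hr : deriv m (z.1 0) ≠ 0 := hm.regular _ hz
  simp only [frameSchwarzian, schwarzian, prolong_one' U.isOpen hm.smooth hz,
    prolong_two U.isOpen hm.smooth hz, prolong_three U.isOpen hm.smooth hz, iteratedDeriv_one]
  field_simp
  ring

/-! ### Smoothness -/

theorem isForm_zero_of_contDiffOn {U : Opens ℝ} {f : PreForm U 0} {N : ℕ}
    {O : Set (Fin N → ℝ)} (hO : IsOpen O) (hOm : ∀ w : Frames U, trunc N w ∈ O)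
    {F : (Fin N → ℝ) → ℝ} (hF : ContDiffOn ℝ ∞ F O) (e : ∀ w v, f w v = F (trunc N w)) :
    IsForm f := fun z =>
  ⟨N, O, hO, hOm z,
    fun x => ContinuousAlternatingMap.constOfIsEmptyLIE ℝ (Fin N → ℝ) ℝ (Fin 0) (F x),
    (ContinuousAlternatingMap.constOfIsEmptyLIE ℝ (Fin N → ℝ) ℝ
      (Fin 0)).toContinuousLinearEquiv.contDiff.comp_contDiffOn hF, fun w _ v => e w v⟩

theorem isOpen_truncFrames (U : Opens ℝ) (N : ℕ) (h : 2 ≤ N) :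
    IsOpen {x : Fin N → ℝ | x ⟨0, by omega⟩ ∈ U ∧ x ⟨1, by omega⟩ ≠ 0} :=
  (U.isOpen.preimage (continuous_apply _)).inter (isOpen_ne.preimage (continuous_apply _))

theorem isForm_one_of_contDiffOn {U : Opens ℝ} {α : PreForm U 1} {N : ℕ}
    {O : Set (Fin N → ℝ)} (hO : IsOpen O) (hOm : ∀ w : Frames U, trunc N w ∈ O)
    {F : Fin N → (Fin N → ℝ) → ℝ} (hF : ∀ j, ContDiffOn ℝ ∞ (F j) O)
    (e : ∀ w v, α w v = ∑ j, F j (trunc N w) * v 0 j) : IsForm α := by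
  intro z
  let A := ContinuousAlternatingMap.ofSubsingletonLIE (𝕜 := ℝ) (E := Fin N → ℝ) (F := ℝ) (0 : Fin 1)
  refine ⟨N, O, hO, hOm z, fun x => A (∑ j, F j x • ContinuousLinearMap.proj j), ?_, ?_⟩
  · refine A.toContinuousLinearEquiv.contDiff.comp_contDiffOn ?_
    exact ContDiffOn.sum fun j _ => (hF j).smul contDiffOn_const
  · intro w _ v
    rw [e]
    simp [A, trunc]

theorem isForm_canonicalForm_three (U : Opens ℝ) : IsForm (canonicalForm U 3) := by
  -- Five coordinates, because the coefficient of `dz₀` contains `z₄`; the coefficient of `dz₄` is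
  -- zero.
  let S : Set (Fin 5 → ℝ) := {x | x 0 ∈ U ∧ x 1 ≠ 0}
  have hc : ∀ j, ContDiffOn ℝ ∞ (fun x : Fin 5 → ℝ => x j) S :=
    fun j => (contDiff_apply ℝ ℝ j).contDiffOn
  have hd : ∀ n : ℕ, ∀ {g : (Fin 5 → ℝ) → ℝ}, ContDiffOn ℝ ∞ g S →
      ContDiffOn ℝ ∞ (fun x => g x / x 1 ^ n) S :=
    fun n g hg => hg.div ((hc 1).pow n) fun x hx => pow_ne_zero n hx.2
  refine isForm_one_of_contDiffOn (O := S) (isOpen_truncFrames U 5 (by norm_num)) (fun w => w.2)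
    (F := ![fun x => x 4 / x 1 ^ 2 + 6 * x 2 ^ 3 / x 1 ^ 4 - 6 * x 2 * x 3 / x 1 ^ 3,
      fun x => 3 * x 3 / x 1 ^ 2 - 6 * x 2 ^ 2 / x 1 ^ 3, fun x => 3 * x 2 / x 1 ^ 2,
      fun x => -1 / x 1 ^ 1, fun _ => 0]) ?_ ?_
  · intro j
    fin_cases j
    · exact ((hd 2 (hc 4)).add (hd 4 (contDiffOn_const.mul ((hc 2).pow 3)))).sub
        (hd 3 ((contDiffOn_const.mul (hc 2)).mul (hc 3)))
    · exact (hd 2 (contDiffOn_const.mul (hc 3))).sub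
        (hd 3 (contDiffOn_const.mul ((hc 2).pow 2)))
    · exact hd 2 (contDiffOn_const.mul (hc 2))
    · exact hd 1 contDiffOn_const
    · exact contDiffOn_const
  · intro w v
    rw [canonicalForm_three_apply]
    simp [Fin.sum_univ_succ, trunc]
    ring

/-! ### Primitives of `θ₃ ∧ θ₁ ∧ θ₀` on one chart -/

/-- The frame with coordinates `(y₀, y₁, 0, 0, …)`. -/
def firstOrderFrame (y : ℝ × ℝ) (n : ℕ) : ℝ := if n = 0 then y.1 else if n = 1 then y.2 else 0

theorem firstOrderFrame_mem {U : Opens ℝ} {y : ℝ × ℝ} (hy : y ∈ Frames₁ U) :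
    firstOrderFrame y ∈ Frames U :=
  ⟨by simpa [firstOrderFrame] using hy.1, by simpa [firstOrderFrame] using hy.2⟩

/-- These frames form a section over the first-order frames on which `S` vanishes, so a primitive
restricts there to `-y₁² q`. -/
theorem frameSchwarzian_firstOrderFrame (y : ℝ × ℝ) :
    frameSchwarzian (firstOrderFrame y) = 0 := by
  simp [frameSchwarzian, firstOrderFrame]

/-- The `0`-form `-S - y₁² q`, where `S` is the Schwarzian derivative of a frame. -/
noncomputable def connectionPrimitive (U : Opens ℝ) (q : ℝ × ℝ → ℝ) : PreForm U 0 :=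
  fun z _ => -frameSchwarzian z.1 - z.1 1 ^ 2 * q (z.1 0, z.1 1)

theorem isOpen_frames₁ (U : Opens ℝ) : IsOpen (Frames₁ U) :=
  (U.isOpen.preimage continuous_fst).inter (isOpen_ne.preimage continuous_snd)

theorem isForm_connectionPrimitive {U : Opens ℝ} {q : ℝ × ℝ → ℝ}
    (hq : ContDiffOn ℝ ∞ q (Frames₁ U)) : IsForm (connectionPrimitive U q) := by
  let S : Set (Fin 4 → ℝ) := {x | x 0 ∈ U ∧ x 1 ≠ 0}
  have hc : ∀ j, ContDiffOn ℝ ∞ (fun x : Fin 4 → ℝ => x j) S :=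
    fun j => (contDiff_apply ℝ ℝ j).contDiffOn
  have h1 : ∀ x ∈ S, x 1 ≠ 0 := fun x hx => hx.2
  refine isForm_zero_of_contDiffOn (O := S) (isOpen_truncFrames U 4 (by norm_num)) (fun w => w.2)
    (F := fun x => -(x 3 / x 1 - 3 / 2 * (x 2 / x 1) ^ 2) - x 1 ^ 2 * q (x 0, x 1)) ?_
    (fun _ _ => rfl)
  have hq' : ContDiffOn ℝ ∞ (fun x : Fin 4 → ℝ => q (x 0, x 1)) S :=
    hq.comp ((hc 0).prodMk (hc 1)) fun x hx => hx
  exact (((hc 3).div (hc 1) h1).sub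
    (contDiffOn_const.mul (((hc 2).div (hc 1) h1).pow 2))).neg.sub (((hc 1).pow 2).mul hq')

/-- The differential of `z₁² q(z₀, z₁)` lies in the span of `dz₀, dz₁` and is killed by `θ₁ ∧ θ₀`;
only `-dS` contributes. -/
theorem d_connectionPrimitive {U : Opens ℝ} {q : ℝ × ℝ → ℝ}
    (hq : ContDiffOn ℝ ∞ q (Frames₁ U)) :
    (((connectionPrimitive U q).wedge (canonicalForm U 1)).wedge (canonicalForm U 0)).d =
      ((canonicalForm U 3).wedge (canonicalForm U 1)).wedge (canonicalForm U 0) := by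
  funext z v
  have h1 : z.1 1 ≠ 0 := z.2.2
  have hz : (z.1 0, z.1 1) ∈ Frames₁ U := z.2
  set L := fderiv ℝ q (z.1 0, z.1 1)
  have hL : HasFDerivAt q L (z.1 0, z.1 1) :=
    ((hq.contDiffAt ((isOpen_frames₁ U).mem_nhds hz)).differentiableAt (by simp)).hasFDerivAt
  -- The partial derivatives of `q` are kept as unknowns; they cancel in the final `ring`.
  have eL : ∀ a b : ℝ, L (a, b) = a * L (1, 0) + b * L (0, 1) := fun a b => by
    have : ((a, b) : ℝ × ℝ) = a • (1, 0) + b • (0, 1) := by simp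
    rw [this, map_add, map_smul, map_smul, smul_eq_mul, smul_eq_mul]
  rw [theta310_apply, d_wedge_theta10 _ z v fun i =>
    -(v i 3 / z.1 1 - z.1 3 * v i 1 / z.1 1 ^ 2 - 3 * z.1 2 * v i 2 / z.1 1 ^ 2
      + 3 * z.1 2 ^ 2 * v i 1 / z.1 1 ^ 3)
      - (2 * z.1 1 * v i 1 * q (z.1 0, z.1 1)
        + z.1 1 ^ 2 * (v i 0 * L (1, 0) + v i 1 * L (0, 1)))]
  · simp only [minor₂, minor₃]
    simp
    field_simp
    ring
  · intro i
    have hb := hasDerivAt_line_coord z.1 (v i)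
    have hq0 : HasDerivAt (fun t : ℝ => q ((z.1 + t • v i) 0, (z.1 + t • v i) 1))
        (v i 0 * L (1, 0) + v i 1 * L (0, 1)) 0 := by
      rw [← eL]
      exact HasFDerivAt.comp_hasDerivAt (0 : ℝ) (by simpa using hL) ((hb 0).prodMk (hb 1))
    have h := (hasDerivAt_line_frameSchwarzian h1 (v i)).fun_neg.fun_sub
      (((hb 1).fun_pow 2).fun_mul hq0)
    refine (h.congr_deriv ?_).congr_of_eventuallyEq ?_
    · simp
    · filter_upwards [PreForm.eventually_mem z (v i)] with t ht
      rw [PreForm.extend_of_mem _ _ ht]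
      rfl

/-- `f + S` has zero derivative along the fibre over `(z₀, z₁)`. The fibre is an affine space, so a
line joins `z` to the first-order frame, where `S = 0`. -/
theorem add_frameSchwarzian_eq_of_d_eq {U : Opens ℝ} {f : PreForm U 0} (hf : f.LineDiff)
    (hd : ((f.wedge (canonicalForm U 1)).wedge (canonicalForm U 0)).d =
      ((canonicalForm U 3).wedge (canonicalForm U 1)).wedge (canonicalForm U 0))
    (z : Frames U) :
    f z ![] + frameSchwarzian z.1 = f.extend ![] (firstOrderFrame (z.1 0, z.1 1)) := by
  have h1 : z.1 1 ≠ 0 := z.2.2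
  set b := firstOrderFrame (z.1 0, z.1 1) with hb
  -- The direction `z - b`: its first two coordinates vanish, so the whole line `b + t • x` lies in
  -- `Frames U`.
  let x : ℕ → ℝ := fun n => if n < 2 then 0 else z.1 n
  have hx0 : x 0 = 0 := by simp [x]
  have hx1 : x 1 = 0 := by simp [x]
  have hmem : ∀ t : ℝ, b + t • x ∈ Frames U := fun t => by
    refine ⟨?_, ?_⟩
    · simpa [hx0, hb, firstOrderFrame] using z.2.1
    · simpa [hx1, hb, firstOrderFrame] using h1
  let h : ℝ → ℝ := fun t => f.extend ![] (b + t • x) + frameSchwarzian (b + t • x)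
  have hder : ∀ t, HasDerivAt h 0 t := by
    intro t
    let w : Frames U := ⟨b + t • x, hmem t⟩
    have hw1 : w.1 1 ≠ 0 := w.2.2
    -- Evaluation on `(x, ∂₁, ∂₀)` isolates the derivative along `x`: the two minors involving `x`
    -- vanish, the remaining one is `1`.
    let v : Fin 3 → ℕ → ℝ := ![x, Pi.single 1 1, Pi.single 0 1]
    have e := d_wedge_theta10 f w v _ fun i => (hf w (v i) ![]).hasDerivAt
    rw [hd, theta310_apply] at e
    have hs := ((hf w x ![]).hasDerivAt).fun_add (hasDerivAt_line_frameSchwarzian hw1 x)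
    have hs' : HasDerivAt (fun s : ℝ => h (s + t)) 0 0 := by
      refine (hs.congr_deriv ?_).congr_of_eventuallyEq (Filter.Eventually.of_forall fun s => ?_)
      · simp [minor₂, minor₃, v, hx0, hx1] at e
        rw [hx1]
        field_simp at e ⊢
        linear_combination (-w.1 1) * e
      · have : b + (s + t) • x = w.1 + s • x := by
          simp only [w, add_smul]; abel
        simp only [h, this]
    -- Line derivatives are available only at parameter `0`, so the derivative at `t` is taken from
    -- the base point `w` and shifted back.
    have ht := HasDerivAt.comp_sub_const t t (f := fun s => h (s + t)) (by simpa using hs')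
    simp only [sub_add_cancel] at ht
    exact ht
  have hconst := is_const_of_deriv_eq_zero (fun t => (hder t).differentiableAt)
    (fun t => (hder t).deriv) 1 0
  have e1 : b + (1 : ℝ) • x = z.1 := by
    funext n
    rcases n with _ | _ | n <;> simp [x, hb, firstOrderFrame]
  have e0 : b + (0 : ℝ) • x = b := by simp
  simp only [h, e1, e0] at hconst
  rw [PreForm.extend_of_mem f ![] z.2, hb, frameSchwarzian_firstOrderFrame, add_zero] at hconst
  exact hconst

theorem contDiffOn_extend_firstOrderFrame {U : Opens ℝ} {f : PreForm U 0} (hf : IsForm f) :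
    ContDiffOn ℝ ∞ (fun y => f.extend ![] (firstOrderFrame y)) (Frames₁ U) := by
  intro y hy
  refine ContDiffAt.contDiffWithinAt ?_
  obtain ⟨N, O, hO, hz, η, hη, e⟩ := hf ⟨_, firstOrderFrame_mem hy⟩
  have hT : ContDiff ℝ ∞ fun y => trunc N (firstOrderFrame y) := by
    refine contDiff_pi.2 fun j => ?_
    simp only [trunc, firstOrderFrame]
    split_ifs
    · exact contDiff_fst
    · exact contDiff_snd
    · exact contDiff_const
  have h1 : ContDiffAt ℝ ∞ (fun y => η (trunc N (firstOrderFrame y))) y :=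
    (hη.contDiffAt (hO.mem_nhds hz)).comp y hT.contDiffAt
  have h2 := (ContinuousAlternatingMap.apply ℝ (Fin N → ℝ) ℝ
    (fun i => trunc N ((![] : Fin 0 → ℕ → ℝ) i))).contDiff.contDiffAt.comp y h1
  refine h2.congr_of_eventuallyEq ?_
  filter_upwards [(isOpen_frames₁ U).mem_nhds hy,
    (hO.preimage hT.continuous).mem_nhds hz] with y' h h'
  rw [PreForm.extend_of_mem _ _ (firstOrderFrame_mem h)]
  exact e ⟨_, firstOrderFrame_mem h⟩ h' ![]

/-! ### The class on a `𝒟₁`-space -/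

namespace D1Space

variable {X : Type*} (D : D1Space X)

/-- Only `θ₃` needs this check: `relForms` asks for smoothness and invariance of the left factor
alone. -/
theorem theta_three_mem_forms : D.theta 3 ∈ D.forms 1 :=
  ⟨fun c => isForm_canonicalForm_three c.1.dom,
    fun _ _ _ hm z v => (canonicalForm_three_framesMap hm.etale z v).symm⟩

theorem theta310_mem_cocycles : D.theta310 ∈ D.cocycles :=
  ⟨⟨D.theta 3, D.theta_three_mem_forms, rfl⟩, funext fun c => d_theta310 c.1.dom⟩

theorem relClass_eq_zero_iff {α : D.Family 3} (h : α ∈ D.cocycles) :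
    D.relClass α h = 0 ↔ ∃ f ∈ D.forms 0,
      D.d (D.wedgeRight (D.theta 0) (D.wedgeRight (D.theta 1) f)) = α := by
  rw [relClass, Submodule.Quotient.mk_eq_zero]
  change α ∈ D.coboundaries ↔ _
  constructor
  · rintro ⟨_, ⟨f, hf, rfl⟩, e⟩
    exact ⟨f, hf, e⟩
  · rintro ⟨f, hf, e⟩
    exact ⟨_, ⟨f, hf, rfl⟩, e⟩

theorem connectionPrimitive_mem_forms {q : D.charts → ℝ × ℝ → ℝ}
    (hq : D.IsFrameProjectiveConnection q) :
    (fun c => connectionPrimitive c.1.dom (q c) : D.Family 0) ∈ D.forms 0 := by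
  refine ⟨fun c => isForm_connectionPrimitive (hq.smooth c), fun c₁ c₂ m hm z v => ?_⟩
  have hr := hq.rule c₁ c₂ m hm _ _ z.2
  have hd : DifferentiableAt ℝ m (z.1 0) :=
    (hm.etale.smooth.contDiffAt (c₁.1.dom.isOpen.mem_nhds z.2.1)).differentiableAt (by simp)
  simp only [connectionPrimitive, framesMap, frameSchwarzian_prolong hm.etale, prolong_zero,
    prolong_one m z.1 hd]
  -- The term `z₁² S(φ)` gained by `S` cancels against the Schwarzian in the rule for `q`, scaled by
  -- `z₁²`.
  linear_combination z.1 1 ^ 2 * hr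

theorem exists_primitive_of_isFrameProjectiveConnection {q : D.charts → ℝ × ℝ → ℝ}
    (hq : D.IsFrameProjectiveConnection q) : ∃ f ∈ D.forms 0,
      D.d (D.wedgeRight (D.theta 0) (D.wedgeRight (D.theta 1) f)) = D.theta310 :=
  ⟨_, D.connectionPrimitive_mem_forms hq, funext fun c => d_connectionPrimitive (hq.smooth c)⟩

/-- Solving `f = -S - y₁² q` for `q` where `S = 0`. -/
theorem isFrameProjectiveConnection_of_primitive {f : D.Family 0} (hf : f ∈ D.forms 0)
    (hd : D.d (D.wedgeRight (D.theta 0) (D.wedgeRight (D.theta 1) f)) = D.theta310) :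
    D.IsFrameProjectiveConnection
      fun c y => -(f c).extend ![] (firstOrderFrame y) / y.2 ^ 2 where
  smooth c := (contDiffOn_extend_firstOrderFrame (hf.1 c)).neg.div
    (contDiff_snd.contDiffOn.pow 2) fun y hy => pow_ne_zero 2 hy.2
  rule c₁ c₂ φ hφ y₀ y₁ hy := by
    have hy1 : y₁ ≠ 0 := hy.2
    have hr : deriv φ y₀ ≠ 0 := hφ.etale.regular _ hy.1
    have hm : firstOrderFrame (y₀, y₁) ∈ Frames c₁.1.dom := firstOrderFrame_mem hy
    let z : Frames c₁.1.dom := ⟨_, hm⟩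
    have z0 : z.1 0 = y₀ := by simp [z, firstOrderFrame]
    have z1 : z.1 1 = y₁ := by simp [z, firstOrderFrame]
    have hdφ : DifferentiableAt ℝ φ (z.1 0) :=
      (hφ.etale.smooth.contDiffAt (c₁.1.dom.isOpen.mem_nhds z.2.1)).differentiableAt (by simp)
    -- `S(φ)` need not map `(y₀, y₁, 0, …)` to a frame of the same kind; constancy of `f + S` on
    -- fibres moves the image back to one, at the cost of its Schwarzian `y₁² S(φ)`.
    have e := add_frameSchwarzian_eq_of_d_eq (PreForm.lineDiff_of_isForm (hf.1 c₂))
      (congrFun hd c₂) (framesMap hφ.etale z)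
    have hinv := hf.2 c₁ c₂ φ hφ z ![]
    rw [Subsingleton.elim (fun i => framesTangent φ z.1 ((![] : Fin 0 → ℕ → ℝ) i)) ![]] at hinv
    rw [← hinv] at e
    simp only [framesMap, frameSchwarzian_prolong hφ.etale, prolong_zero, prolong_one φ z.1 hdφ,
      z0, z1] at e
    rw [show frameSchwarzian z.1 = 0 from frameSchwarzian_firstOrderFrame _] at e
    simp only
    rw [← e, PreForm.extend_of_mem _ _ hm]
    field_simp
    ring

variable {D} in
theorem IsProjectiveConnection.isFrameProjectiveConnection {q : D.charts → ℝ → ℝ}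
    (hq : D.IsProjectiveConnection q) : D.IsFrameProjectiveConnection fun c y => q c y.1 where
  smooth c := (hq.smooth c).comp contDiff_fst.contDiffOn fun _ hy => hy.1
  rule c₁ c₂ φ hφ _ _ hy := hq.rule c₁ c₂ φ hφ _ hy.1

end D1Space

theorem mainTheorem12 {X : Type*} (D : D1Space X) :
    ∃ h : D.theta310 ∈ D.cocycles,
      (D.relClass D.theta310 h = 0 ↔
        ∃ q : D.charts → ℝ × ℝ → ℝ, D.IsFrameProjectiveConnection q) ∧
      ((∃ q : D.charts → ℝ → ℝ, D.IsProjectiveConnection q) →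
        D.relClass D.theta310 h = 0) := by
  refine ⟨D.theta310_mem_cocycles, ?_⟩
  rw [D.relClass_eq_zero_iff]
  refine ⟨⟨?_, ?_⟩, ?_⟩
  · rintro ⟨f, hf, hd⟩
    exact ⟨_, D.isFrameProjectiveConnection_of_primitive hf hd⟩
  · rintro ⟨q, hq⟩
    exact D.exists_primitive_of_isFrameProjectiveConnection hq
  · rintro ⟨q, hq⟩
    exact D.exists_primitive_of_isFrameProjectiveConnection hq.isFrameProjectiveConnection
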